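/- Let $n$ be a nonnegative integer and let $U$ be a linear subspace of $\mathbb{R}^n$ (with the standard inner product). Then the following are equivalent. 1. $U$ is recoverable by minimum trace factor analysis (MTFA): for every diagonal matrix $D^\star\in\mathbb{R}^{n\times n}$ and every symmetric positive semidefinite matrix $L^\star\in\mathbb{R}^{n\times n}$ with column space $U$, the pair $(D^\star,L^\star)$ is the unique optimal solution of $$\min_{D,L}\ \operatorname{tr}(L)\quad\text{subject to}\quad X=D+L,\ L\succeq 0,\ D\ \text{diagonal},$$ with input $X=D^\star+L^\star$. 2. $U$ is realizable: there is an $n\times n$ correlation matrix $Q$ (a symmetric positive semidefinite matrix with all diagonal entries equal to $1$) whose nullspace contains $U$. 3. The orthogonal complement $U^\perp$ has the ellipsoid fitting property: for some $k\ge 0$ there are a $k\times n$ real matrix $V$ with row space $U^\perp$ and a centered ellipsoid in $\mathbb{R}^k$ passing through each column of $V$. Here a centered ellipsoid in $\mathbb{R}^k$ means a set $\{x\in\mathbb{R}^k : x^T M x=1\}$ with $M$ a symmetric positive semidefinite $k\times k$ matrix (possibly singular, so that degenerate ellipsoids are allowed). -/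

import Mathlib

open scoped Matrix

noncomputable section

/-- The column space of a real matrix. -/
def columnSpace {m n : ℕ} (A : Matrix (Fin m) (Fin n) ℝ) :
    Submodule ℝ (EuclideanSpace ℝ (Fin m)) :=
  LinearMap.range (Matrix.toEuclideanLin A)

/-- The row space of a real matrix. -/
def rowSpace {m n : ℕ} (A : Matrix (Fin m) (Fin n) ℝ) :
    Submodule ℝ (EuclideanSpace ℝ (Fin n)) :=
  columnSpace Aᵀ

/-- The nullspace of a real matrix. -/
def nullSpace {m n : ℕ} (A : Matrix (Fin m) (Fin n) ℝ) :
    Submodule ℝ (EuclideanSpace ℝ (Fin n)) :=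
  LinearMap.ker (Matrix.toEuclideanLin A)

/-- `(D, L)` is feasible for minimum trace factor analysis (MTFA) with input `X`. -/
def IsMTFAFeasible {n : ℕ} (X D L : Matrix (Fin n) (Fin n) ℝ) : Prop :=
  X = D + L ∧ L.PosSemidef ∧ D.IsDiag

/-- `(D, L)` is optimal for MTFA with input `X`: minimize `tr L` over the feasible pairs. -/
def IsMTFAOptimal {n : ℕ} (X D L : Matrix (Fin n) (Fin n) ℝ) : Prop :=
  IsMTFAFeasible X D L ∧
    ∀ D' L' : Matrix (Fin n) (Fin n) ℝ, IsMTFAFeasible X D' L' → L.trace ≤ L'.trace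

/-- `(D, L)` is the unique optimum of MTFA with input `X`. -/
def IsUniqueMTFAOptimum {n : ℕ} (X D L : Matrix (Fin n) (Fin n) ℝ) : Prop :=
  IsMTFAOptimal X D L ∧
    ∀ D' L' : Matrix (Fin n) (Fin n) ℝ, IsMTFAOptimal X D' L' → D' = D ∧ L' = L

/-- `U` is recoverable by MTFA. -/
def RecoverableByMTFA {n : ℕ} (U : Submodule ℝ (EuclideanSpace ℝ (Fin n))) : Prop :=
  ∀ D L : Matrix (Fin n) (Fin n) ℝ, D.IsDiag → L.PosSemidef → columnSpace L = U →
    IsUniqueMTFAOptimum (D + L) D L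

/-- Correlation matrices: positive semidefinite matrices with unit diagonal. -/
def IsCorrelationMatrix {n : ℕ} (Q : Matrix (Fin n) (Fin n) ℝ) : Prop :=
  Q.PosSemidef ∧ ∀ i, Q i i = 1

/-- `U` is realizable: it is contained in the nullspace of some correlation matrix. -/
def Realizable {n : ℕ} (U : Submodule ℝ (EuclideanSpace ℝ (Fin n))) : Prop :=
  ∃ Q : Matrix (Fin n) (Fin n) ℝ, IsCorrelationMatrix Q ∧ U ≤ nullSpace Q

/-- A (boundary of a) centered ellipsoid in `ℝᵏ`: a set `{x | xᵀ M x = 1}` with `M` symmetric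
positive semidefinite. Degenerate (unbounded) ellipsoids, for which `M` is singular, are
allowed. -/
def IsCenteredEllipsoid {k : ℕ} (E : Set (EuclideanSpace ℝ (Fin k))) : Prop :=
  ∃ M : Matrix (Fin k) (Fin k) ℝ, M.PosSemidef ∧ E = {x | x.ofLp ⬝ᵥ M *ᵥ x.ofLp = 1}

/-- The ellipsoid fitting property of a subspace `W` of `ℝⁿ`: for some `k`, there is a `k × n`
matrix `V` with row space `W` and a centered ellipsoid passing through each column of `V`. -/
def EllipsoidFittingProperty {n : ℕ} (W : Submodule ℝ (EuclideanSpace ℝ (Fin n))) : Prop :=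
  ∃ (k : ℕ) (V : Matrix (Fin k) (Fin n) ℝ) (E : Set (EuclideanSpace ℝ (Fin k))),
    rowSpace V = W ∧ IsCenteredEllipsoid E ∧ ∀ i : Fin n, WithLp.toLp 2 (fun j => V j i) ∈ E

end

/-! The equivalence of recoverability and realizability is semidefinite duality. A correlation
matrix `Q` killing `U` is a dual certificate: for any feasible `L'`, `tr (Q L') = tr L' - tr L`,
which is nonnegative, and equality forces `Q L' = 0`, whose diagonal gives `D' = D`. Conversely, if
no such `Q` exists, Hahn–Banach separates the all-ones vector from the compact convex set of
diagonals of `traceSlice U n`. Testing the separating functional on rank-one matrices `w wᵀ` with `w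
∈ Uᗮ` gives a diagonal matrix of negative trace, positive definite on `Uᗮ`; by Finsler's lemma,
adding it to a large multiple of the projection onto `U` yields a feasible point of smaller trace.
Ellipsoid fitting restates realizability through `Q = Vᵀ M V`. -/

theorem ofLp_toEuclideanLin {m n : ℕ} (A : Matrix (Fin m) (Fin n) ℝ)
    (x : EuclideanSpace ℝ (Fin n)) : (Matrix.toEuclideanLin A x).ofLp = A *ᵥ x.ofLp :=
  rfl

theorem mem_nullSpace_iff {m n : ℕ} {A : Matrix (Fin m) (Fin n) ℝ} {x : EuclideanSpace ℝ (Fin n)} :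
    x ∈ nullSpace A ↔ A *ᵥ x.ofLp = 0 := by
  rw [nullSpace, LinearMap.mem_ker, ← WithLp.ofLp_eq_zero 2, ofLp_toEuclideanLin]

theorem columnSpace_le_nullSpace_iff {l m n : ℕ} {A : Matrix (Fin l) (Fin m) ℝ}
    {B : Matrix (Fin m) (Fin n) ℝ} : columnSpace B ≤ nullSpace A ↔ A * B = 0 := by
  constructor
  · intro h
    apply Matrix.ext_of_mulVec_single
    intro i
    have := mem_nullSpace_iff.1 (h ⟨WithLp.toLp 2 (Pi.single i 1), rfl⟩)
    rw [ofLp_toEuclideanLin] at this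
    rw [← Matrix.mulVec_mulVec, Matrix.zero_mulVec]
    exact this
  · rintro h _ ⟨x, rfl⟩
    rw [mem_nullSpace_iff, ofLp_toEuclideanLin, Matrix.mulVec_mulVec, h,
      Matrix.zero_mulVec]

theorem nullSpace_eq_orthogonal_rowSpace {m n : ℕ} (A : Matrix (Fin m) (Fin n) ℝ) :
    nullSpace A = (rowSpace A)ᗮ := by
  rw [rowSpace, columnSpace, LinearMap.orthogonal_range,
    ← Matrix.toEuclideanLin_conjTranspose_eq_adjoint, Matrix.conjTranspose_eq_transpose_of_trivial,
    Matrix.transpose_transpose, nullSpace]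

theorem dotProduct_mulVec_eq_inner {n : ℕ} (A : Matrix (Fin n) (Fin n) ℝ)
    (x : EuclideanSpace ℝ (Fin n)) :
    x.ofLp ⬝ᵥ A *ᵥ x.ofLp = inner ℝ x (Matrix.toEuclideanLin A x) := by
  rw [EuclideanSpace.inner_eq_star_dotProduct, star_trivial, dotProduct_comm,
    ofLp_toEuclideanLin]

/-! ### Trace inequalities for positive semidefinite matrices -/

namespace Matrix.PosSemidef

open scoped MatrixOrder in
theorem exists_eq_conjTranspose_mul_self {n : ℕ} {A : Matrix (Fin n) (Fin n) ℝ}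
    (hA : A.PosSemidef) : ∃ B : Matrix (Fin n) (Fin n) ℝ, A = Bᴴ * B :=
  CStarAlgebra.nonneg_iff_eq_star_mul_self.1 hA.nonneg

/-- The trace pairing of two positive semidefinite matrices is nonnegative. -/
theorem trace_mul_nonneg {n : ℕ} {A B : Matrix (Fin n) (Fin n) ℝ} (hA : A.PosSemidef)
    (hB : B.PosSemidef) : 0 ≤ (A * B).trace := by
  obtain ⟨C, rfl⟩ := hA.exists_eq_conjTranspose_mul_self
  rw [Matrix.mul_assoc, Matrix.trace_mul_comm]
  exact (hB.mul_mul_conjTranspose_same C).trace_nonneg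

/-- Positive semidefinite matrices that are orthogonal for the trace pairing have product zero. -/
theorem mul_eq_zero_of_trace_mul_eq_zero {n : ℕ} {A B : Matrix (Fin n) (Fin n) ℝ}
    (hA : A.PosSemidef) (hB : B.PosSemidef) (h : (A * B).trace = 0) : A * B = 0 := by
  obtain ⟨C, rfl⟩ := hA.exists_eq_conjTranspose_mul_self
  obtain ⟨E, rfl⟩ := hB.exists_eq_conjTranspose_mul_self
  -- By cyclicity the pairing is the squared Frobenius norm of `C * Eᴴ`.
  have h0 : ((C * Eᴴ)ᴴ * (C * Eᴴ)).trace = 0 := by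
    rw [← h, Matrix.conjTranspose_mul, Matrix.conjTranspose_conjTranspose,
      show E * Cᴴ * (C * Eᴴ) = (E * (Cᴴ * C)) * Eᴴ by simp only [Matrix.mul_assoc],
      Matrix.mul_assoc, Matrix.trace_mul_comm]
    simp only [Matrix.mul_assoc]
  rw [Matrix.trace_conjTranspose_mul_self_eq_zero_iff] at h0
  rw [show Cᴴ * C * (Eᴴ * E) = Cᴴ * (C * Eᴴ) * E by simp only [Matrix.mul_assoc], h0]
  simp

/-- Testing on `e_i ± e_j` gives `2 |A i j| ≤ A i i + A j j`. This makes `traceSlice` bounded. -/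
theorem abs_apply_le_trace {n : ℕ} {A : Matrix (Fin n) (Fin n) ℝ} (hA : A.PosSemidef)
    (i j : Fin n) : |A i j| ≤ A.trace := by
  have hd (k : Fin n) : A k k ≤ A.trace :=
    Finset.single_le_sum (f := fun k => A k k) (fun k _ => hA.diag_nonneg) (Finset.mem_univ k)
  have hs : A j i = A i j := by simpa using hA.1.apply i j
  have hp (c : ℝ) : 0 ≤ A i i + 2 * c * A i j + c ^ 2 * A j j := by
    have := hA.dotProduct_mulVec_nonneg (Pi.single i 1 + c • Pi.single j 1)
    simp only [star_trivial, Matrix.mulVec_add, Matrix.mulVec_smul, Matrix.mulVec_single_one,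
      add_dotProduct, dotProduct_add, smul_dotProduct, dotProduct_smul, single_one_dotProduct,
      Matrix.col_apply, smul_eq_mul, hs] at this
    linarith
  rw [abs_le]
  constructor <;> linarith [hp 1, hp (-1), hd i, hd j]

end Matrix.PosSemidef

theorem isClosed_setOf_posSemidef (n : ℕ) :
    IsClosed {A : Matrix (Fin n) (Fin n) ℝ | A.PosSemidef} := by
  simp only [Matrix.posSemidef_iff_dotProduct_mulVec, Set.ofPred_and, Set.ofPred_forall]
  refine IsClosed.inter ?_ (isClosed_iInter fun x => ?_)
  · exact isClosed_eq (by fun_prop) continuous_id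
  · exact isClosed_le continuous_const (by fun_prop)

/-- The positive semidefinite matrices of trace `c` that vanish on `U`. -/
def traceSlice {n : ℕ} (U : Submodule ℝ (EuclideanSpace ℝ (Fin n))) (c : ℝ) :
    Set (Matrix (Fin n) (Fin n) ℝ) :=
  {Q | Q.PosSemidef ∧ U ≤ nullSpace Q ∧ Q.trace = c}

theorem isCompact_traceSlice {n : ℕ} (U : Submodule ℝ (EuclideanSpace ℝ (Fin n))) (c : ℝ) :
    IsCompact (traceSlice U c) := by
  have hK : IsCompact (Set.univ.pi fun _ : Fin n => Set.univ.pi fun _ : Fin n => Set.Icc (-c) c) :=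
    isCompact_univ_pi fun _ => isCompact_univ_pi fun _ => isCompact_Icc
  refine IsCompact.of_isClosed_subset hK ?_ ?_
  · refine (isClosed_setOf_posSemidef n).inter (IsClosed.inter ?_ ?_)
    · have : {Q : Matrix (Fin n) (Fin n) ℝ | U ≤ nullSpace Q} =
          ⋂ x ∈ U, {Q : Matrix (Fin n) (Fin n) ℝ | Q.mulVec x.ofLp = 0} := by
        ext Q
        simp only [Set.mem_ofPred_eq, Set.mem_iInter, SetLike.le_def, mem_nullSpace_iff]
      change IsClosed {Q : Matrix (Fin n) (Fin n) ℝ | U ≤ nullSpace Q}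
      rw [this]
      exact isClosed_biInter fun x _ => isClosed_eq (by fun_prop) continuous_const
    · exact isClosed_eq (by fun_prop) continuous_const
  · rintro Q ⟨hQ, -, rfl⟩ i - j -
    exact abs_le.1 (hQ.abs_apply_le_trace i j)

theorem convex_traceSlice {n : ℕ} (U : Submodule ℝ (EuclideanSpace ℝ (Fin n))) (c : ℝ) :
    Convex ℝ (traceSlice U c) := by
  rintro A ⟨hA, hAU, hAc⟩ B ⟨hB, hBU, hBc⟩ a b ha hb hab
  refine ⟨(hA.smul ha).add (hB.smul hb), fun x hx => ?_, ?_⟩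
  · rw [mem_nullSpace_iff, Matrix.add_mulVec, Matrix.smul_mulVec, Matrix.smul_mulVec,
      mem_nullSpace_iff.1 (hAU hx), mem_nullSpace_iff.1 (hBU hx)]
    simp
  · rw [Matrix.trace_add, Matrix.trace_smul, Matrix.trace_smul, hAc, hBc, ← add_smul, hab, one_smul]

/-! ### Orthogonal projections and Finsler's lemma -/

/-- The matrix of the orthogonal projection onto `W`. -/
noncomputable def projectionMatrix {n : ℕ} (W : Submodule ℝ (EuclideanSpace ℝ (Fin n))) :
    Matrix (Fin n) (Fin n) ℝ :=
  Matrix.toEuclideanLin.symm (W.starProjection : EuclideanSpace ℝ (Fin n) →ₗ[ℝ] _)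

section projectionMatrix

variable {n : ℕ} (W : Submodule ℝ (EuclideanSpace ℝ (Fin n)))

theorem toEuclideanLin_projectionMatrix :
    Matrix.toEuclideanLin (projectionMatrix W) =
      (W.starProjection : EuclideanSpace ℝ (Fin n) →ₗ[ℝ] _) :=
  LinearEquiv.apply_symm_apply _ _

theorem posSemidef_projectionMatrix : (projectionMatrix W).PosSemidef := by
  rw [← Matrix.isPositive_toEuclideanLin_iff, toEuclideanLin_projectionMatrix]
  exact (ContinuousLinearMap.IsPositive.of_isStarProjection
    isStarProjection_starProjection).toLinearMap

theorem columnSpace_projectionMatrix : columnSpace (projectionMatrix W) = W := by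
  rw [columnSpace, toEuclideanLin_projectionMatrix]
  exact Submodule.range_starProjection W

theorem rowSpace_projectionMatrix : rowSpace (projectionMatrix W) = W := by
  have h := (posSemidef_projectionMatrix W).1
  rw [Matrix.IsHermitian, Matrix.conjTranspose_eq_transpose_of_trivial] at h
  rw [rowSpace, h, columnSpace_projectionMatrix]

theorem projectionMatrix_mulVec (x : EuclideanSpace ℝ (Fin n)) :
    (projectionMatrix W).mulVec x.ofLp = (W.starProjection x).ofLp := by
  rw [← ofLp_toEuclideanLin, toEuclideanLin_projectionMatrix]
  rfl

end projectionMatrix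

/-- Finsler's lemma: a diagonal matrix that is positive definite on the complement of `U` becomes
positive semidefinite after adding a large multiple of the projection onto `U`. -/
theorem exists_posSemidef_smul_projectionMatrix_add_diagonal {n : ℕ}
    (U : Submodule ℝ (EuclideanSpace ℝ (Fin n))) (d : Fin n → ℝ) {ε : ℝ} (hε : 0 < ε)
    (h : ∀ w ∈ Uᗮ, ε * ‖w‖ ^ 2 ≤ w.ofLp ⬝ᵥ Matrix.diagonal d *ᵥ w.ofLp) :
    ∃ t : ℝ, 0 < t ∧ (t • projectionMatrix U + Matrix.diagonal d).PosSemidef := by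
  have hd : (Matrix.diagonal d).IsHermitian := Matrix.isHermitian_diagonal d
  set T := Matrix.toEuclideanLin (Matrix.diagonal d) with hT
  have hTs : T.IsSymmetric := Matrix.isSymmetric_toEuclideanLin_iff.2 hd
  set c := ‖T.toContinuousLinearMap‖ with hc
  have hc0 : 0 ≤ c := norm_nonneg _
  have hb (x y : EuclideanSpace ℝ (Fin n)) : -(c * ‖x‖ * ‖y‖) ≤ inner ℝ x (T y) := by
    have h1 := abs_real_inner_le_norm x (T y)
    have h2 : ‖T y‖ ≤ c * ‖y‖ := T.toContinuousLinearMap.le_opNorm y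
    have h3 := mul_le_mul_of_nonneg_left h2 (norm_nonneg x)
    linarith [(abs_le.1 h1).1]
  -- `c` absorbs the form on the `U`-component, `c ^ 2 / ε` completes the square with the cross
  -- term, and `1` keeps `t` positive when `c = 0`.
  refine ⟨c + c ^ 2 / ε + 1, by positivity, ?_⟩
  set t := c + c ^ 2 / ε + 1 with ht
  refine Matrix.PosSemidef.of_dotProduct_mulVec_nonneg
    (((posSemidef_projectionMatrix U).smul (by positivity : 0 ≤ t)).1.add hd) fun x => ?_
  obtain ⟨u, hu, w, hw, hx⟩ := U.exists_add_mem_mem_orthogonal (WithLp.toLp 2 x)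
  have hPx : U.starProjection (WithLp.toLp 2 x) = u := by
    rw [hx, map_add, Submodule.starProjection_eq_self_iff.2 hu,
      (Submodule.starProjection_apply_eq_zero_iff U).2 hw, add_zero]
  have huw : inner ℝ w u = 0 := Submodule.inner_left_of_mem_orthogonal hu hw
  have hq1 : x ⬝ᵥ projectionMatrix U *ᵥ x = ‖u‖ ^ 2 := by
    have := dotProduct_mulVec_eq_inner (projectionMatrix U) (WithLp.toLp 2 x)
    rw [toEuclideanLin_projectionMatrix, ContinuousLinearMap.coe_coe, hPx, hx, inner_add_left,
      huw, add_zero, real_inner_self_eq_norm_sq] at this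
    rw [← this, ← hx]
  have hq2 : x ⬝ᵥ Matrix.diagonal d *ᵥ x =
      inner ℝ u (T u) + 2 * inner ℝ u (T w) + inner ℝ w (T w) := by
    have := dotProduct_mulVec_eq_inner (Matrix.diagonal d) (WithLp.toLp 2 x)
    have hs : inner ℝ w (T u) = inner ℝ u (T w) := by rw [← hTs, real_inner_comm]
    rw [← hT, hx, map_add, inner_add_left, inner_add_right, inner_add_right, hs, ← hx] at this
    change x ⬝ᵥ Matrix.diagonal d *ᵥ x = _ at this
    rw [this]
    ring
  have hw' := h w hw
  rw [dotProduct_mulVec_eq_inner, ← hT] at hw'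
  have hsq : ε * ‖w‖ ^ 2 - 2 * (c * ‖u‖ * ‖w‖) + c ^ 2 / ε * ‖u‖ ^ 2 =
      (ε * ‖w‖ - c * ‖u‖) ^ 2 / ε := by
    field_simp
    ring
  have hsq0 : 0 ≤ (ε * ‖w‖ - c * ‖u‖) ^ 2 / ε := by positivity
  rw [star_trivial, Matrix.add_mulVec, dotProduct_add, Matrix.smul_mulVec, dotProduct_smul,
    hq1, hq2, smul_eq_mul]
  nlinarith [hb u u, hb u w, sq_nonneg ‖u‖]

/-! ### Duality between recoverability and realizability -/

theorem Realizable.recoverableByMTFA {n : ℕ} {U : Submodule ℝ (EuclideanSpace ℝ (Fin n))}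
    (h : Realizable U) : RecoverableByMTFA U := by
  obtain ⟨Q, ⟨hQ, hQ1⟩, hQU⟩ := h
  intro D L hD hL hLU
  have hQL : Q * L = 0 := columnSpace_le_nullSpace_iff.1 (hLU.trans_le hQU)
  have key (D' L' : Matrix (Fin n) (Fin n) ℝ) (hf : IsMTFAFeasible (D + L) D' L') :
      Q * L' = Q * (D - D') ∧ (Q * L').trace = L'.trace - L.trace := by
    obtain ⟨hX, -, hD'⟩ := hf
    have hL' : L' = L + (D - D') := by
      rw [show L + (D - D') = D + L - D' by abel, hX, add_sub_cancel_left]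
    have h1 : Q * L' = Q * (D - D') := by rw [hL', Matrix.mul_add, hQL, zero_add]
    refine ⟨h1, ?_⟩
    rw [h1, hL', Matrix.trace_add, add_sub_cancel_left]
    have hdiag : D - D' = Matrix.diagonal (D - D').diag :=
      ((hD.sub hD').diagonal_diag).symm
    rw [hdiag]
    simp [Matrix.trace, Matrix.mul_diagonal, hQ1]
  have hopt : IsMTFAOptimal (D + L) D L := by
    refine ⟨⟨rfl, hL, hD⟩, fun D' L' hf => ?_⟩
    have := hQ.trace_mul_nonneg hf.2.1
    rw [(key D' L' hf).2] at this
    linarith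
  refine ⟨hopt, fun D' L' ho => ?_⟩
  have hf := ho.1
  have htr : L'.trace = L.trace := le_antisymm (ho.2 D L hopt.1) (hopt.2 D' L' hf)
  have h0 : Q * L' = 0 := hQ.mul_eq_zero_of_trace_mul_eq_zero hf.2.1 <| by
    rw [(key D' L' hf).2, htr, sub_self]
  have hDD : D' = D := by
    rw [(key D' L' hf).1, ← (hD.sub hf.2.2).diagonal_diag] at h0
    ext i j
    by_cases hij : i = j
    · subst hij
      have := congrFun (congrFun h0 i) i
      simp only [Matrix.mul_diagonal, hQ1, one_mul, Matrix.diag_apply, Matrix.sub_apply,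
        Matrix.zero_apply] at this
      linarith
    · rw [hD hij, hf.2.2 hij]
  refine ⟨hDD, ?_⟩
  have := hf.1
  rw [hDD] at this
  exact (add_left_cancel this).symm

theorem dotProduct_diagonal_mulVec_self {n : ℕ} (d w : Fin n → ℝ) :
    w ⬝ᵥ Matrix.diagonal d *ᵥ w = ∑ i, d i * w i ^ 2 := by
  simp only [dotProduct, Matrix.mulVec_diagonal]
  exact Finset.sum_congr rfl fun i _ => by ring

/-- If `U` is not realizable, some diagonal matrix of negative trace is positive definite on the
orthogonal complement of `U`. -/
theorem exists_sum_neg_of_not_realizable {n : ℕ} {U : Submodule ℝ (EuclideanSpace ℝ (Fin n))}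
    (h : ¬ Realizable U) : ∃ (d : Fin n → ℝ) (ε : ℝ), 0 < ε ∧ ∑ i, d i < 0 ∧
      ∀ w ∈ Uᗮ, ε * ‖w‖ ^ 2 ≤ w.ofLp ⬝ᵥ Matrix.diagonal d *ᵥ w.ofLp := by
  have hn : n ≠ 0 := by
    rintro rfl
    exact h ⟨0, ⟨Matrix.PosSemidef.zero, fun i => i.elim0⟩, fun x _ => mem_nullSpace_iff.2 (by simp)⟩
  have hn0 : (0 : ℝ) < n := by positivity
  set K := Matrix.diagLinearMap (Fin n) ℝ ℝ '' traceSlice U n with hK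
  have hKc : IsCompact K := (isCompact_traceSlice U n).image (LinearMap.continuous_of_finiteDimensional _)
  have h1 : (1 : Fin n → ℝ) ∉ K := by
    rintro ⟨Q, ⟨hQ, hQU, -⟩, hQ1⟩
    exact h ⟨Q, ⟨hQ, fun i => congrFun hQ1 i⟩, hQU⟩
  obtain ⟨f, u, hf1, hfK⟩ := geometric_hahn_banach_point_closed
    ((convex_traceSlice U n).linear_image _) hKc.isClosed h1
  obtain ⟨s, hs1, hs2⟩ := exists_between hf1
  have hf (v : Fin n → ℝ) : f v = ∑ i, f (Pi.single i 1) * v i := by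
    conv_lhs => rw [pi_eq_sum_univ' v, map_sum]
    exact Finset.sum_congr rfl fun i _ => by rw [map_smul, smul_eq_mul, mul_comm]
  -- Shifting by `s / n` subtracts `s` from `f` at the all-ones vector and on `K` alike, since both
  -- have coordinate sum `n`; as `f 1 < s < u`, the signs become opposite.
  refine ⟨fun i => f (Pi.single i 1) - s / n, (u - s) / n, div_pos (sub_pos.2 hs2) hn0, ?_, ?_⟩
  · have := hf 1
    simp only [Pi.one_apply, mul_one] at this
    rw [Finset.sum_sub_distrib, ← this]
    simp only [Finset.sum_const, Finset.card_univ, Fintype.card_fin, nsmul_eq_mul]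
    rw [mul_div_cancel₀ _ hn0.ne']
    linarith
  · intro w hw
    by_cases hw0 : w = 0
    · simp [hw0]
    have hnw : 0 < ‖w‖ ^ 2 := by positivity
    have hsum : ∑ i, w i ^ 2 = ‖w‖ ^ 2 := (EuclideanSpace.real_norm_sq_eq w).symm
    set a := (n : ℝ) / ‖w‖ ^ 2 with ha
    have hmem : a • Matrix.vecMulVec w.ofLp w.ofLp ∈ traceSlice U n := by
      refine ⟨?_, fun x hx => ?_, ?_⟩
      · have := (Matrix.posSemidef_vecMulVec_self_star w.ofLp).smul (by positivity : 0 ≤ a)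
        simpa only [star_trivial] using this
      · have h0 : w.ofLp ⬝ᵥ x.ofLp = 0 := by
          have := Submodule.inner_right_of_mem_orthogonal hx hw
          rwa [EuclideanSpace.inner_eq_star_dotProduct, star_trivial] at this
        rw [mem_nullSpace_iff, Matrix.smul_mulVec, Matrix.vecMulVec_mulVec, h0]
        simp
      · rw [Matrix.trace_smul, Matrix.trace_vecMulVec, dotProduct]
        simp only [← pow_two, hsum, smul_eq_mul]
        exact div_mul_cancel₀ _ hnw.ne'
    have hlt := hfK _ ⟨_, hmem, rfl⟩
    rw [hf] at hlt
    have hlt' : u < a * ∑ i, f (Pi.single i 1) * w i ^ 2 := by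
      rw [Finset.mul_sum]
      refine hlt.trans_eq (Finset.sum_congr rfl fun i _ => ?_)
      simp [Matrix.vecMulVec_apply]
      ring
    rw [dotProduct_diagonal_mulVec_self]
    simp only [sub_mul, Finset.sum_sub_distrib, ← Finset.mul_sum, hsum]
    rw [ha, div_mul_eq_mul_div, lt_div_iff₀ hnw] at hlt'
    have : u * ‖w‖ ^ 2 / n ≤ ∑ i, f (Pi.single i 1) * w i ^ 2 := by
      rw [div_le_iff₀ hn0, mul_comm _ (n : ℝ)]
      exact hlt'.le
    calc (u - s) / n * ‖w‖ ^ 2 = u * ‖w‖ ^ 2 / n - s / n * ‖w‖ ^ 2 := by ring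
      _ ≤ _ := by linarith

theorem RecoverableByMTFA.realizable {n : ℕ} {U : Submodule ℝ (EuclideanSpace ℝ (Fin n))}
    (h : RecoverableByMTFA U) : Realizable U := by
  by_contra hU
  obtain ⟨d, ε, hε, hd, hpos⟩ := exists_sum_neg_of_not_realizable hU
  obtain ⟨t, ht, hps⟩ := exists_posSemidef_smul_projectionMatrix_add_diagonal U d hε hpos
  have hcol : columnSpace (t • projectionMatrix U) = U := by
    rw [columnSpace, map_smul, LinearMap.range_smul _ _ ht.ne']
    exact columnSpace_projectionMatrix U
  have hopt := (h 0 (t • projectionMatrix U) Matrix.isDiag_zero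
    ((posSemidef_projectionMatrix U).smul ht.le) hcol).1
  -- Moving `diagonal d` into the `L` part preserves `X` and lowers the trace.
  have := hopt.2 (-Matrix.diagonal d) (t • projectionMatrix U + Matrix.diagonal d)
    ⟨by abel, hps, (Matrix.isDiag_diagonal d).neg⟩
  rw [Matrix.trace_add, Matrix.trace_diagonal] at this
  linarith

/-! ### Realizability and ellipsoid fitting -/

theorem transpose_mul_mul_apply {k n : ℕ} (V : Matrix (Fin k) (Fin n) ℝ)
    (M : Matrix (Fin k) (Fin k) ℝ) (i : Fin n) :
    (Vᵀ * M * V) i i = (fun j => V j i) ⬝ᵥ M *ᵥ (fun j => V j i) := by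
  rw [Matrix.mul_assoc]
  rfl

theorem EllipsoidFittingProperty.realizable {n : ℕ} {U : Submodule ℝ (EuclideanSpace ℝ (Fin n))}
    (h : EllipsoidFittingProperty Uᗮ) : Realizable U := by
  obtain ⟨k, V, _, hV, ⟨M, hM, rfl⟩, hcols⟩ := h
  refine ⟨Vᵀ * M * V, ⟨?_, fun i => ?_⟩, fun x hx => ?_⟩
  · simpa only [Matrix.conjTranspose_eq_transpose_of_trivial] using hM.conjTranspose_mul_mul_same V
  · rw [transpose_mul_mul_apply]
    exact hcols i
  · rw [← U.orthogonal_orthogonal, ← hV, ← nullSpace_eq_orthogonal_rowSpace,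
      mem_nullSpace_iff] at hx
    rw [mem_nullSpace_iff, ← Matrix.mulVec_mulVec, hx, Matrix.mulVec_zero]

theorem Realizable.ellipsoidFittingProperty {n : ℕ} {U : Submodule ℝ (EuclideanSpace ℝ (Fin n))}
    (h : Realizable U) : EllipsoidFittingProperty Uᗮ := by
  obtain ⟨Q, ⟨hQ, hQ1⟩, hQU⟩ := h
  -- With `V = P` and `M = Q`, `Pᵀ Q P = Q` because `Q` is symmetric and kills `U`.
  set P := projectionMatrix Uᗮ with hP
  have hQP : Q * P = Q := by
    apply Matrix.ext_of_mulVec_single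
    intro i
    set x : EuclideanSpace ℝ (Fin n) := WithLp.toLp 2 (Pi.single i 1) with hx
    rw [← Matrix.mulVec_mulVec]
    change Q *ᵥ (P *ᵥ x.ofLp) = Q *ᵥ x.ofLp
    have h0 := mem_nullSpace_iff.1 (hQU (U.starProjection_apply_mem x))
    rw [hP, projectionMatrix_mulVec, Submodule.starProjection_orthogonal_val, WithLp.ofLp_sub,
      Matrix.mulVec_sub, h0, sub_zero]
  have hPQ : Pᵀ * Q = Q := by
    have hQt : Qᵀ = Q := by
      rw [← Matrix.conjTranspose_eq_transpose_of_trivial]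
      exact hQ.1
    conv_rhs => rw [← hQt, ← hQP, Matrix.transpose_mul, hQt]
  refine ⟨n, P, _, rowSpace_projectionMatrix Uᗮ, ⟨Q, hQ, rfl⟩, fun i => ?_⟩
  change (fun j => P j i) ⬝ᵥ Q *ᵥ (fun j => P j i) = 1
  rw [← transpose_mul_mul_apply, hPQ, hQP, hQ1]

theorem proposition3p1 (n : ℕ) (U : Submodule ℝ (EuclideanSpace ℝ (Fin n))) :
    List.TFAE [RecoverableByMTFA U, Realizable U, EllipsoidFittingProperty Uᗮ] := by
  tfae_have 1 → 2 := RecoverableByMTFA.realizable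
  tfae_have 2 → 1 := Realizable.recoverableByMTFA
  tfae_have 2 → 3 := Realizable.ellipsoidFittingProperty
  tfae_have 3 → 2 := EllipsoidFittingProperty.realizable
  tfae_finish
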